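/- Let $K$ be an ordered field that contains a positive square root $\sqrt2$ of $2$ (for example $K=\mathbb R$), and let $n\ge 0$. Let $A_n$ be the Weyl algebra, that is, the algebra under composition $\circ$ of the differential operators on $K[x_1,\dots,x_n]$ generated by multiplication by the variables $x_i$ and by the derivations $\partial_i=\partial/\partial x_i$. The monomials $x^\alpha\partial^\beta$ ($\alpha,\beta\in\mathbb Z_{\ge0}^n$) form a basis of $A_n$. Define $K$-linear maps $X\mapsto\overline X$ from $A_n$ to $A_n$ and $T:A_n\to K$ by $$\overline{x^\alpha\partial^\beta}=x^\beta\partial^\alpha,\qquad T(x^\alpha\partial^\alpha)=\alpha!=\alpha_1!\cdots\alpha_n!,\qquad T(x^\alpha\partial^\beta)=0\ \text{ if }\alpha\neq\beta,$$ and put $(X,Y)=T(X\circ Y)$. The weight of $x^\alpha\partial^\beta$ is $l(x^\alpha\partial^\beta)=\sum_{i=1}^n(\alpha_i-\beta_i)\in\mathbb Z$. Let $\langle\;,\;\rangle:A_n\times A_n\to K$ be the bilinear form determined by $$\langle X,Y\rangle=\sqrt2^{\,l(X)}\,(X,\overline Y)$$ for $Y\in A_n$ and for $X$ a monomial $x^\alpha\partial^\beta$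 (hence for every $X$ that is homogeneous of weight $l(X)$). Let $A_n^{(+)}$ be the subspace of $A_n$ generated by the self-adjoint operators, $\overline X=X$, and let $A_n^{(-)}$ be the subspace generated by the skew-adjoint operators, $\overline X=-X$. Then the restriction of $\langle\;,\;\rangle$ to $A_n^{(+)}$ and its restriction to $A_n^{(-)}$ are symmetric and positive definite, that is, $\langle X,Y\rangle=\langle Y,X\rangle$, $\langle X,X\rangle\ge0$, and $\langle X,X\rangle=0$ implies $X=0$, for all $X,Y$ in the subspace. Moreover the two subspaces are mutually orthogonal: $\langle X,Y\rangle=\langle Y,X\rangle=0$ for all $X\in A_n^{(+)}$ and $Y\in A_n^{(-)}$. -/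

import Mathlib

namespace Weyl

noncomputable section

open MvPolynomial

variable (K : Type*) [Field K] (n : ℕ)

/-- Linear operators on the polynomial algebra `U_n = K[x_1, …, x_n]`. -/
abbrev PolyEnd := Module.End K (MvPolynomial (Fin n) K)

variable {n}

/-- The operator of multiplication by the variable `x_i`. -/
def xOp (i : Fin n) : PolyEnd K n := LinearMap.mulLeft K (X i)

/-- The partial derivative `∂_i`, as a linear operator. -/
def dOp (i : Fin n) : PolyEnd K n := (pderiv i : Derivation K _ (MvPolynomial (Fin n) K)).toLinearMap

/-- The Weyl monomial `x^α ∂^β = x_1^{α_1} ⋯ x_n^{α_n} ∂_1^{β_1} ⋯ ∂_n^{β_n}`. -/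
def monomOp (α β : Fin n →₀ ℕ) : PolyEnd K n :=
  (List.ofFn fun i => xOp K i ^ α i).prod * (List.ofFn fun i => dOp K i ^ β i).prod

variable (n)

/-- The Weyl algebra `A_n`: the algebra of differential operators on `K[x_1, …, x_n]` generated
by the `x_i` and the `∂_i`, with composition as product. -/
def weylAlgebra : Subalgebra K (PolyEnd K n) :=
  Algebra.adjoin K (Set.range (xOp K) ∪ Set.range (dOp K))

variable {n}

theorem xOp_mem (i : Fin n) : xOp K i ∈ weylAlgebra K n :=
  Algebra.subset_adjoin (Set.mem_union_left _ (Set.mem_range_self i))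

theorem dOp_mem (i : Fin n) : dOp K i ∈ weylAlgebra K n :=
  Algebra.subset_adjoin (Set.mem_union_right _ (Set.mem_range_self i))

theorem monomOp_mem (α β : Fin n →₀ ℕ) : monomOp K α β ∈ weylAlgebra K n := by
  refine mul_mem (list_prod_mem ?_) (list_prod_mem ?_)
  · intro f hf
    obtain ⟨i, rfl⟩ := (List.mem_ofFn' _ _).1 hf
    exact pow_mem (xOp_mem K i) _
  · intro f hf
    obtain ⟨i, rfl⟩ := (List.mem_ofFn' _ _).1 hf
    exact pow_mem (dOp_mem K i) _

/-- The Weyl monomial `x^α ∂^β`, as an element of `A_n`. -/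
def monom (α β : Fin n →₀ ℕ) : weylAlgebra K n := ⟨monomOp K α β, monomOp_mem K α β⟩

/-! ### The Weyl monomials form a basis of `A_n` -/

theorem list_sum_single (β : Fin n →₀ ℕ) :
    ((List.finRange n).map fun i => Finsupp.single i (β i)).sum = β := by
  rw [← List.ofFn_eq_map, List.sum_ofFn]
  exact Finsupp.univ_sum_single β

theorem xProd_eq (α : Fin n →₀ ℕ) :
    (List.ofFn fun i => xOp K i ^ α i).prod = LinearMap.mulLeft K (monomial α (1 : K)) := by
  have h : ∀ l : List (Fin n), (l.map fun i => xOp K i ^ α i).prod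
      = LinearMap.mulLeft K
        (monomial (l.map fun i => Finsupp.single i (α i)).sum (1 : K)) := by
    intro l
    induction l with
    | nil => ext; simp
    | cons i l ih =>
      rw [List.map_cons, List.prod_cons, ih, List.map_cons, List.sum_cons, xOp,
        LinearMap.pow_mulLeft, X_pow_eq_monomial]
      apply LinearMap.ext
      intro p
      simp only [Module.End.mul_apply, LinearMap.mulLeft_apply, ← mul_assoc, monomial_mul, one_mul]
  rw [List.ofFn_eq_map, h, list_sum_single]

theorem dOp_pow_monomial (i : Fin n) (k : ℕ) (γ : Fin n →₀ ℕ) (c : K) :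
    (dOp K i ^ k) (monomial γ c)
      = monomial (γ - Finsupp.single i k) (c * ((γ i).descFactorial k : ℕ)) := by
  induction k with
  | zero => simp
  | succ k ih =>
    rw [pow_succ', Module.End.mul_apply, ih]
    have : ∀ p, dOp K i p = pderiv i p := fun _ => rfl
    rw [this, pderiv_monomial, tsub_tsub, ← Finsupp.single_add]
    congr 1
    rw [Nat.descFactorial_succ]
    simp only [Finsupp.coe_tsub, Pi.sub_apply, Finsupp.single_eq_same]
    push_cast
    ring

theorem dProd_monomial (β γ : Fin n →₀ ℕ) (c : K) :
    (List.ofFn fun i => dOp K i ^ β i).prod (monomial γ c)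
      = monomial (γ - β) (c * ((∏ i, (γ i).descFactorial (β i) : ℕ) : K)) := by
  have h : ∀ l : List (Fin n), l.Nodup → (l.map fun i => dOp K i ^ β i).prod (monomial γ c)
      = monomial (γ - (l.map fun i => Finsupp.single i (β i)).sum)
        (c * (((l.map fun i => (γ i).descFactorial (β i)).prod : ℕ) : K)) := by
    intro l
    induction l with
    | nil => simp
    | cons i l ih =>
      intro hl
      rw [List.nodup_cons] at hl
      have h0 : (l.map fun j => Finsupp.single j (β j)).sum i = 0 := by
        have : ∀ m : List (Fin n), i ∉ m → (m.map fun j => Finsupp.single j (β j)).sum i = 0 := by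
          intro m
          induction m with
          | nil => simp
          | cons j m ihm =>
            intro hm
            rw [List.mem_cons, not_or] at hm
            rw [List.map_cons, List.sum_cons, Finsupp.add_apply, ihm hm.2,
              Finsupp.single_eq_of_ne hm.1]
        exact this l hl.1
      rw [List.map_cons, List.prod_cons, Module.End.mul_apply, ih hl.2, dOp_pow_monomial,
        List.map_cons, List.sum_cons, List.map_cons, List.prod_cons, tsub_tsub, add_comm]
      congr 1
      rw [Finsupp.tsub_apply, h0]
      push_cast
      simp only [tsub_zero]
      ring
  rw [List.ofFn_eq_map, h _ (List.nodup_finRange n), list_sum_single, ← List.ofFn_eq_map,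
    List.prod_ofFn]

theorem monomOp_monomial (α β γ : Fin n →₀ ℕ) :
    monomOp K α β (monomial γ 1)
      = monomial (α + (γ - β)) ((∏ i, (γ i).descFactorial (β i) : ℕ) : K) := by
  rw [monomOp, Module.End.mul_apply, dProd_monomial, xProd_eq, LinearMap.mulLeft_apply,
    monomial_mul, one_mul, one_mul]

theorem xOp_mul_monomOp (i : Fin n) (α β : Fin n →₀ ℕ) :
    xOp K i * monomOp K α β = monomOp K (α + Finsupp.single i 1) β := by
  rw [monomOp, monomOp, ← mul_assoc, xProd_eq, xProd_eq, xOp]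
  congr 1
  apply LinearMap.ext
  intro p
  simp only [X, Module.End.mul_apply, LinearMap.mulLeft_apply, ← mul_assoc, monomial_mul, one_mul,
    add_comm]

theorem dOp_mul_monomOp (i : Fin n) (α β : Fin n →₀ ℕ) :
    dOp K i * monomOp K α β = monomOp K α (β + Finsupp.single i 1)
      + (α i : K) • monomOp K (α - Finsupp.single i 1) β := by
  have hd : (List.ofFn fun j => dOp K j ^ ((β + Finsupp.single i 1 : Fin n →₀ ℕ) j)).prod
      = dOp K i * (List.ofFn fun j => dOp K j ^ β j).prod := by
    ext1 γ
    ext1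
    change (List.ofFn fun j => dOp K j ^ ((β + Finsupp.single i 1 : Fin n →₀ ℕ) j)).prod
      (monomial γ 1) = dOp K i ((List.ofFn fun j => dOp K j ^ β j).prod (monomial γ 1))
    rw [dProd_monomial, dProd_monomial, ← pow_one (dOp K i), dOp_pow_monomial, tsub_tsub]
    congr 1
    rw [one_mul, one_mul, ← Nat.cast_mul]
    congr 1
    rw [← Finset.mul_prod_erase _ _ (Finset.mem_univ i),
      ← Finset.mul_prod_erase _ (fun j => (γ j).descFactorial (β j)) (Finset.mem_univ i)]
    have : ∀ j ∈ Finset.univ.erase i, (γ j).descFactorial ((β + Finsupp.single i 1 : Fin n →₀ ℕ) j)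
        = (γ j).descFactorial (β j) := by
      intro j hj
      rw [Finsupp.add_apply, Finsupp.single_eq_of_ne (Finset.ne_of_mem_erase hj), add_zero]
    rw [Finset.prod_congr rfl this]
    simp only [Finsupp.add_apply, Finsupp.single_eq_same, Nat.descFactorial_succ,
      Finsupp.tsub_apply, Nat.descFactorial_zero, tsub_zero, mul_one]
    ring
  rw [monomOp, monomOp, monomOp, hd, xProd_eq, xProd_eq]
  apply LinearMap.ext
  intro p
  simp only [Module.End.mul_apply, LinearMap.add_apply, LinearMap.smul_apply,
    LinearMap.mulLeft_apply]
  generalize (List.ofFn fun j => dOp K j ^ β j).prod p = q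
  have : ∀ p, dOp K i p = pderiv i p := fun _ => rfl
  rw [this, this, Derivation.leibniz, pderiv_monomial, smul_eq_mul, smul_eq_mul, one_mul,
    mul_comm q, ← smul_mul_assoc, smul_monomial, smul_eq_mul, mul_one]

theorem monomOp_zero : monomOp K (0 : Fin n →₀ ℕ) 0 = 1 := by
  rw [monomOp, xProd_eq]
  ext
  simp

theorem mem_span_monomOp {f : PolyEnd K n} (hf : f ∈ weylAlgebra K n) :
    f ∈ Submodule.span K (Set.range fun p : (Fin n →₀ ℕ) × (Fin n →₀ ℕ) =>
      monomOp K p.1 p.2) := by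
  set S := Submodule.span K (Set.range fun p : (Fin n →₀ ℕ) × (Fin n →₀ ℕ) =>
      monomOp K p.1 p.2) with hS
  have hb : ∀ α β, monomOp K α β ∈ S := fun α β => Submodule.subset_span ⟨(α, β), rfl⟩
  suffices h : ∀ g ∈ S, f * g ∈ S by
    have := h 1 (monomOp_zero K (n := n) ▸ hb 0 0)
    rwa [mul_one] at this
  refine Algebra.adjoin_induction (p := fun f _ => ∀ g ∈ S, f * g ∈ S) ?_ ?_ ?_ ?_ hf
  · rintro f hf g hg
    refine Submodule.span_induction (p := fun g _ => f * g ∈ S) ?_ ?_ ?_ ?_ hg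
    · rintro _ ⟨p, rfl⟩
      rcases hf with ⟨i, rfl⟩ | ⟨i, rfl⟩
      · simp only [xOp_mul_monomOp]
        exact hb _ _
      · simp only [dOp_mul_monomOp]
        exact S.add_mem (hb _ _) (S.smul_mem _ (hb _ _))
    · simp
    · intro a b _ _ ha hb'
      rw [mul_add]
      exact S.add_mem ha hb'
    · intro c a _ ha
      rw [mul_smul_comm]
      exact S.smul_mem _ ha
  · intro c g hg
    rw [← Algebra.smul_def]
    exact S.smul_mem _ hg
  · intro a b _ _ ha hb' g hg
    rw [add_mul]
    exact S.add_mem (ha g hg) (hb' g hg)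
  · intro a b _ _ ha hb' g hg
    rw [mul_assoc]
    exact ha _ (hb' g hg)

theorem span_monom :
    ⊤ ≤ Submodule.span K (Set.range fun p : (Fin n →₀ ℕ) × (Fin n →₀ ℕ) => monom K p.1 p.2) := by
  rintro ⟨f, hf⟩ -
  have h := mem_span_monomOp K hf
  have hr : (Set.range fun p : (Fin n →₀ ℕ) × (Fin n →₀ ℕ) => monomOp K p.1 p.2)
      = (weylAlgebra K n).val.toLinearMap ''
        (Set.range fun p : (Fin n →₀ ℕ) × (Fin n →₀ ℕ) => monom K p.1 p.2) := by
    rw [← Set.range_comp]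
    rfl
  rw [hr, ← Submodule.map_span] at h
  obtain ⟨g, hg, hgf⟩ := h
  have : g = ⟨f, hf⟩ := Subtype.ext hgf
  exact this ▸ hg

theorem linearIndependent_monom [CharZero K] :
    LinearIndependent K (fun p : (Fin n →₀ ℕ) × (Fin n →₀ ℕ) => monom K p.1 p.2) := by
  have h : LinearIndependent K (fun p : (Fin n →₀ ℕ) × (Fin n →₀ ℕ) => monomOp K p.1 p.2) := by
    rw [linearIndependent_iff]
    intro c hc
    suffices H : ∀ β α, c (α, β) = 0 by
      ext ⟨α, β⟩
      exact H β α
    intro β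
    induction β using WellFoundedLT.induction with
    | ind β ih =>
      intro α
      have h1 := congrArg (fun f : PolyEnd K n => coeff α (f (monomial β 1))) hc
      simp only [Finsupp.linearCombination_apply, Finsupp.sum, LinearMap.sum_apply,
        LinearMap.smul_apply, coeff_sum, coeff_smul, monomOp_monomial, LinearMap.zero_apply,
        coeff_zero, smul_eq_mul, coeff_monomial] at h1
      rw [Finset.sum_eq_single (α, β)] at h1
      · simp only [tsub_self, add_zero, if_true, Nat.descFactorial_self] at h1
        refine (mul_eq_zero.1 h1).resolve_right ?_
        exact_mod_cast Finset.prod_ne_zero_iff.2 fun i _ => Nat.factorial_ne_zero _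
      · rintro ⟨α', β'⟩ - hne
        simp only
        by_cases hle : β' ≤ β
        · rcases eq_or_lt_of_le hle with rfl | hlt
          · have : α' ≠ α := fun h => hne (by rw [h])
            simp [this]
          · rw [ih β' hlt, zero_mul]
        · have : ∃ i, β i < β' i := by
            by_contra! hcon
            exact hle hcon
          obtain ⟨i, hi⟩ := this
          rw [Finset.prod_eq_zero (Finset.mem_univ i) (Nat.descFactorial_of_lt hi)]
          simp
      · intro hn
        rw [Finsupp.notMem_support_iff.1 hn, zero_mul]
  exact LinearIndependent.of_comp (weylAlgebra K n).val.toLinearMap h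

variable (n)

/-- The basis of `A_n` that consists of the Weyl monomials `x^α ∂^β`. -/
def weylBasis [CharZero K] :
    Module.Basis ((Fin n →₀ ℕ) × (Fin n →₀ ℕ)) K (weylAlgebra K n) :=
  Module.Basis.mk (linearIndependent_monom K) (span_monom K)

variable {K n}

/-! ### The forms -/

section Forms

variable [CharZero K]

/-- The linear map `X ↦ X̄` with `x^α ∂^β ↦ x^β ∂^α`. -/
def bar : weylAlgebra K n →ₗ[K] weylAlgebra K n :=
  (weylBasis K n).constr K fun p => monom K p.2 p.1

/-- The linear map `T : A_n → K` with `T(x^α ∂^α) = α!` and `T(x^α ∂^β) = 0` for `α ≠ β`. -/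
def T : weylAlgebra K n →ₗ[K] K :=
  (weylBasis K n).constr K fun p => if p.1 = p.2 then ((∏ i, (p.1 i).factorial : ℕ) : K) else 0

/-- The weight `l(x^α ∂^β) = ∑ i, (α_i - β_i)` of a Weyl monomial. -/
def weight (α β : Fin n →₀ ℕ) : ℤ := ∑ i, ((α i : ℤ) - (β i : ℤ))

/-- The linear map `X ↦ r^{l(X)} X`: it multiplies each operator of weight `l` by `r ^ l`. -/
def weightScale (r : K) : weylAlgebra K n →ₗ[K] weylAlgebra K n :=
  (weylBasis K n).constr K fun p => r ^ weight p.1 p.2 • monom K p.1 p.2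

/-- The bilinear form `(X, Y) = T(X ∘ Y)`. -/
def frobeniusForm : LinearMap.BilinForm K (weylAlgebra K n) :=
  (LinearMap.mul K (weylAlgebra K n)).compr₂ T

/-- The bilinear form `⟨X, Y⟩ = r^{l(X)} (X, Ȳ)` (to be used with `r = √2`). -/
def euclidForm (r : K) : LinearMap.BilinForm K (weylAlgebra K n) :=
  frobeniusForm.compl₁₂ (weightScale r) bar

variable (K n)

/-- `A_n^{(+)}`, the subspace generated by the self-adjoint operators. -/
def selfAdjointOps : Submodule K (weylAlgebra K n) := Submodule.span K {X | bar X = X}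

/-- `A_n^{(-)}`, the subspace generated by the skew-adjoint operators. -/
def skewAdjointOps : Submodule K (weylAlgebra K n) := Submodule.span K {X | bar X = -X}

end Forms

/-- A symmetric and positive definite bilinear form on a vector space over an ordered field. -/
structure IsEuclidean {F V : Type*} [Field F] [LinearOrder F]
    [AddCommMonoid V] [Module F V] (B : LinearMap.BilinForm F V) : Prop where
  symm : ∀ x y, B x y = B y x
  nonneg : ∀ x, 0 ≤ B x x
  definite : ∀ x, B x x = 0 → x = 0

end

end Weyl

namespace Weyl

noncomputable section

open MvPolynomial

variable {K : Type*} [Field K] {n : ℕ}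

/-! The form is positive definite on all of `A_n`, because it is the pullback of an explicit scalar
product under an injective linear map; both restrictions inherit this.

The operators `p_i + ∂/∂q_i` and `q_i + 2 ∂/∂p_i` on `K[p, q]` satisfy the Weyl relations of `x_i`
and `∂_i`, so they make `K[p, q]` an `A_n`-module, and `symbol X` is `X` applied to `1`. It is
injective since `x^α ∂^β` goes to `p^α q^β` plus terms of lower degree.

On `A_n`, the identity `T (X * x_i) = 2 * T (x_i * X)` and `r ^ 2 = 2` show that left multiplication
by `x_i` has adjoint `r⁻¹ ∂_i` (`euclidForm_xGen_mul`). If monomials of `K[p, q]` are orthogonal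
with square norms `m! r^{|m|}`, multiplication by a variable has adjoint `r` times its derivative,
so the module operators obey the same rule (`polyForm_shiftOp`). Moving generators across reduces
the comparison to `X = 1`, where `T Y` must be the constant term of `symbol Y`; this gives
`euclidForm_eq_polyForm`.

For orthogonality, the bar map is an isometry (`euclidForm_bar_bar`), so `⟨X, Y⟩ = -⟨X, Y⟩` when `X`
is self-adjoint and `Y` skew-adjoint. -/

theorem finsupp_nat_induction {ι : Type*} {p : (ι →₀ ℕ) → Prop} (h0 : p 0)
    (hs : ∀ α i, p α → p (α + Finsupp.single i 1)) (α : ι →₀ ℕ) : p α := by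
  -- `Finsupp.induction` adds a whole block `single i k` at once, so the unit steps are iterated to
  -- a block.
  have h : ∀ (k : ℕ) (i : ι) (α : ι →₀ ℕ), p α → p (α + Finsupp.single i k) := by
    intro k i
    induction k with
    | zero => intro α hα; simpa using hα
    | succ k ih =>
      intro α hα
      rw [Finsupp.single_add, ← add_assoc]
      exact hs _ _ (ih α hα)
  induction α using Finsupp.induction with
  | zero => exact h0
  | single_add i k α _ _ ih => rw [add_comm]; exact h k i α ih

/-- The coefficient bookkeeping behind `[∂_i, x_j] = δ_{ij}`. -/
theorem nsmul_shift_add_ite {ι M : Type*} [DecidableEq ι] [AddCommMonoid M] (F : (ι →₀ ℕ) → M)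
    (α : ι →₀ ℕ) (i j : ι) :
    α i • F (α - Finsupp.single i 1 + Finsupp.single j 1) + (if i = j then F α else 0)
      = (α + Finsupp.single j 1 : ι →₀ ℕ) i • F (α + Finsupp.single j 1 - Finsupp.single i 1) := by
  by_cases hij : i = j
  · subst hij
    rw [if_pos rfl, add_tsub_cancel_right, Finsupp.add_apply, Finsupp.single_eq_same, succ_nsmul]
    congr 1
    rcases Nat.eq_zero_or_pos (α i) with h | h
    · simp [h]
    · rw [tsub_add_cancel_of_le (Finsupp.single_le_iff.2 h)]
  · rw [if_neg hij, add_zero, Finsupp.add_apply, Finsupp.single_eq_of_ne hij, add_zero]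
    congr 2
    ext k
    simp only [Finsupp.add_apply, Finsupp.tsub_apply]
    by_cases hk : k = i
    · subst hk
      rw [Finsupp.single_eq_of_ne hij]
      simp
    · rw [Finsupp.single_eq_of_ne hk]
      simp

/-! ### Multiplication of Weyl monomials by generators -/

/-- The variable `x_i`, as an element of `A_n`. -/
def xGen (i : Fin n) : weylAlgebra K n := ⟨xOp K i, xOp_mem K i⟩

/-- The derivation `∂_i`, as an element of `A_n`. -/
def dGen (i : Fin n) : weylAlgebra K n := ⟨dOp K i, dOp_mem K i⟩

theorem xGen_mul_monom (i : Fin n) (α β : Fin n →₀ ℕ) :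
    xGen i * monom K α β = monom K (α + Finsupp.single i 1) β :=
  Subtype.ext (xOp_mul_monomOp K i α β)

theorem dGen_mul_monom (i : Fin n) (α β : Fin n →₀ ℕ) :
    dGen i * monom K α β
      = monom K α (β + Finsupp.single i 1) + α i • monom K (α - Finsupp.single i 1) β := by
  rw [← Nat.cast_smul_eq_nsmul K]
  exact Subtype.ext (dOp_mul_monomOp K i α β)

theorem monom_zero_zero : monom K (0 : Fin n →₀ ℕ) 0 = 1 := Subtype.ext (monomOp_zero K)

theorem dGen_mul_monom_zero (i : Fin n) (β : Fin n →₀ ℕ) :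
    dGen i * monom K 0 β = monom K 0 (β + Finsupp.single i 1) := by
  simp [dGen_mul_monom]

theorem monom_mul_dGen (α β : Fin n →₀ ℕ) (i : Fin n) :
    monom K α β * dGen i = monom K α (β + Finsupp.single i 1) := by
  induction α using finsupp_nat_induction with
  | h0 =>
    induction β using finsupp_nat_induction with
    | h0 => rw [monom_zero_zero, one_mul, ← dGen_mul_monom_zero, monom_zero_zero, mul_one]
    | hs β j ih =>
      rw [← dGen_mul_monom_zero, mul_assoc, ih, dGen_mul_monom_zero, add_right_comm]
  | hs α j ih => rw [← xGen_mul_monom, mul_assoc, ih, xGen_mul_monom]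

theorem monom_mul_xGen (α β : Fin n →₀ ℕ) (i : Fin n) :
    monom K α β * xGen i
      = monom K (α + Finsupp.single i 1) β + β i • monom K α (β - Finsupp.single i 1) := by
  induction α using finsupp_nat_induction with
  | h0 =>
    induction β using finsupp_nat_induction with
    | h0 => rw [monom_zero_zero, one_mul, ← xGen_mul_monom, monom_zero_zero]; simp
    | hs β j ih =>
      -- Moving `∂_j` past `x_i` leaves the extra term `∂^β` exactly when `i = j`;
      -- `nsmul_shift_add_ite` absorbs it into the coefficient.
      rw [← dGen_mul_monom_zero, mul_assoc, ih, mul_add, mul_smul_comm, dGen_mul_monom_zero,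
        dGen_mul_monom, ← nsmul_shift_add_ite, add_assoc, zero_add, add_comm (β i • _)]
      congr 2
      by_cases h : i = j
      · simp [h]
      · simp [h]
  | hs α j ih =>
    rw [← xGen_mul_monom, mul_assoc, ih, mul_add, mul_smul_comm, xGen_mul_monom, xGen_mul_monom,
      add_right_comm]

/-- A property of elements of `A_n` that holds at `1` and is inherited by left multiples by
generators holds at all Weyl monomials. -/
theorem monom_induction {p : weylAlgebra K n → Prop} (h1 : p 1) (hx : ∀ i X, p X → p (xGen i * X))
    (hd : ∀ i X, p X → p (dGen i * X)) (α β : Fin n →₀ ℕ) : p (monom K α β) := by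
  induction α using finsupp_nat_induction with
  | h0 =>
    induction β using finsupp_nat_induction with
    | h0 => rwa [monom_zero_zero]
    | hs β j ih => rw [← dGen_mul_monom_zero]; exact hd _ _ ih
  | hs α j ih => rw [← xGen_mul_monom]; exact hx _ _ ih

theorem linear_induction {p : weylAlgebra K n → Prop} (hm : ∀ α β, p (monom K α β))
    (ha : ∀ X Y, p X → p Y → p (X + Y)) (hs : ∀ (c : K) X, p X → p (c • X))
    (X : weylAlgebra K n) : p X := by
  refine Submodule.span_induction (p := fun X _ => p X) ?_ ?_ (fun X Y _ _ => ha X Y)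
    (fun c X _ => hs c X) (span_monom K (Submodule.mem_top (x := X)))
  · rintro _ ⟨q, rfl⟩
    exact hm _ _
  · simpa using hs 0 _ (hm 0 0)

/-! ### The bar map, the weight scaling, the functional `T` and adjoints of left multiplications -/

section Forms

variable [CharZero K]

theorem weylBasis_apply (p : (Fin n →₀ ℕ) × (Fin n →₀ ℕ)) :
    weylBasis K n p = monom K p.1 p.2 := by
  simp [weylBasis]

theorem constr_monom {M : Type*} [AddCommMonoid M] [Module K M]
    (f : (Fin n →₀ ℕ) × (Fin n →₀ ℕ) → M) (α β : Fin n →₀ ℕ) :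
    (weylBasis K n).constr K f (monom K α β) = f (α, β) := by
  rw [← weylBasis_apply (α, β), Module.Basis.constr_basis]

theorem bar_monom (α β : Fin n →₀ ℕ) : bar (monom K α β) = monom K β α := constr_monom _ α β

theorem T_monom (α β : Fin n →₀ ℕ) :
    T (monom K α β) = if α = β then ((∏ i, (α i).factorial : ℕ) : K) else 0 := constr_monom _ α β

theorem weightScale_monom (r : K) (α β : Fin n →₀ ℕ) :
    weightScale r (monom K α β) = r ^ weight α β • monom K α β := constr_monom _ α β

theorem bar_one : bar (1 : weylAlgebra K n) = 1 := by
  rw [← monom_zero_zero, bar_monom]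

theorem weightScale_one (r : K) : weightScale r (1 : weylAlgebra K n) = 1 := by
  rw [← monom_zero_zero, weightScale_monom]
  simp [weight]

theorem bar_bar (X : weylAlgebra K n) : bar (bar X) = X := by
  induction X using linear_induction with
  | hm α β =>
    simp [bar_monom]
  | ha X Y hX hY => simp only [map_add, hX, hY]
  | hs c X hX => simp only [map_smul, hX]

/-- With `bar_dGen_mul`, this is all that is needed of the fact that bar is an anti-automorphism
exchanging `x_i` and `∂_i`. -/
theorem bar_xGen_mul (i : Fin n) (X : weylAlgebra K n) : bar (xGen i * X) = bar X * dGen i := by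
  induction X using linear_induction with
  | hm α β =>
    simp [bar_monom, xGen_mul_monom, monom_mul_dGen]
  | ha X Y hX hY => simp only [mul_add, add_mul, map_add, hX, hY]
  | hs c X hX => simp only [mul_smul_comm, smul_mul_assoc, map_smul, hX]

theorem bar_dGen_mul (i : Fin n) (X : weylAlgebra K n) : bar (dGen i * X) = bar X * xGen i := by
  induction X using linear_induction with
  | hm α β =>
    rw [dGen_mul_monom, bar_monom, monom_mul_xGen, map_add, map_nsmul, bar_monom, bar_monom]
  | ha X Y hX hY => simp only [mul_add, add_mul, map_add, hX, hY]
  | hs c X hX => simp only [mul_smul_comm, smul_mul_assoc, map_smul, hX]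

theorem weight_add_single_left (α β : Fin n →₀ ℕ) (i : Fin n) :
    weight (α + Finsupp.single i 1) β = weight α β + 1 := by
  have : ∑ j, ((Finsupp.single i 1 : Fin n →₀ ℕ) j : ℤ) = 1 := by
    simp [Finsupp.single_apply]
  rw [weight, weight, ← this, ← Finset.sum_add_distrib]
  refine Finset.sum_congr rfl fun j _ => ?_
  rw [Finsupp.add_apply]
  push_cast
  ring

theorem weight_swap (α β : Fin n →₀ ℕ) : weight β α = -weight α β := by
  rw [weight, weight, ← Finset.sum_neg_distrib]
  exact Finset.sum_congr rfl fun j _ => (neg_sub _ _).symm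

theorem weight_add_single_right (α β : Fin n →₀ ℕ) (i : Fin n) :
    weight α (β + Finsupp.single i 1) = weight α β - 1 := by
  rw [weight_swap, weight_add_single_left, weight_swap α β]
  ring

/-- Scaling by weight is the automorphism `x_i ↦ r x_i`, `∂_i ↦ r⁻¹ ∂_i`, which preserves `[∂_i,
x_i] = 1`. -/
theorem weightScale_xGen_mul {r : K} (hr : r ≠ 0) (i : Fin n) (X : weylAlgebra K n) :
    weightScale r (xGen i * X) = r • (xGen i * weightScale r X) := by
  induction X using linear_induction with
  | hm α β =>
    simp only [xGen_mul_monom, weightScale_monom, mul_smul_comm, smul_smul, weight_add_single_left]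
    rw [zpow_add_one₀ hr, mul_comm]
  | ha X Y hX hY => simp only [mul_add, smul_add, map_add, hX, hY]
  | hs c X hX => simp only [mul_smul_comm, map_smul, hX, smul_comm c]

theorem weightScale_dGen_mul {r : K} (hr : r ≠ 0) (i : Fin n) (X : weylAlgebra K n) :
    weightScale r (dGen i * X) = r⁻¹ • (dGen i * weightScale r X) := by
  induction X using linear_induction with
  | hm α β =>
    simp only [map_add, map_nsmul, dGen_mul_monom, weightScale_monom, mul_smul_comm, smul_smul,
      smul_add, weight_add_single_right]
    congr 1
    · rw [zpow_sub_one₀ hr, mul_comm]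
    -- The subtraction in `α - single i 1` is truncated, so its weight is the expected one only for
    -- `α i > 0`; otherwise the coefficient kills the term.
    · rcases Nat.eq_zero_or_pos (α i) with h | h
      · simp [h]
      · have hw := weight_add_single_left (α - Finsupp.single i 1) β i
        rw [tsub_add_cancel_of_le (Finsupp.single_le_iff.2 h)] at hw
        rw [hw, zpow_add_one₀ hr, smul_comm, mul_comm, mul_assoc, mul_inv_cancel₀ hr, mul_one]
  | ha X Y hX hY => simp only [mul_add, smul_add, map_add, hX, hY]
  | hs c X hX => simp only [mul_smul_comm, map_smul, hX, smul_comm c]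

/-- Both sides vanish unless `β = α + e_i`, and then `(α + e_i)! = (α_i + 1) α!`. -/
theorem T_monom_add_single (α β : Fin n →₀ ℕ) (i : Fin n) :
    T (monom K (α + Finsupp.single i 1) β)
      = β i • T (monom K α (β - Finsupp.single i 1)) := by
  rw [T_monom, T_monom]
  rcases Nat.eq_zero_or_pos (β i) with h | h
  · rw [h, zero_smul, if_neg]
    rintro rfl
    simp at h
  · obtain ⟨γ, rfl⟩ : ∃ γ, β = γ + Finsupp.single i 1 :=
      ⟨_, (tsub_add_cancel_of_le (Finsupp.single_le_iff.2 h)).symm⟩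
    rw [add_tsub_cancel_right]
    simp only [add_left_inj]
    by_cases hα : α = γ
    · subst hα
      rw [if_pos rfl, if_pos rfl, nsmul_eq_mul, ← Nat.cast_mul,
        ← Finset.mul_prod_erase _ _ (Finset.mem_univ i),
        ← Finset.mul_prod_erase _ (fun j => (α j).factorial) (Finset.mem_univ i), ← mul_assoc]
      congr 2
      · simp [Nat.factorial_succ]
      · refine Finset.prod_congr rfl fun j hj => ?_
        rw [Finsupp.add_apply, Finsupp.single_eq_of_ne (Finset.ne_of_mem_erase hj), add_zero]
    · rw [if_neg hα, if_neg hα, smul_zero]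

/-- The source of `√2`: on `X = x^α ∂^β` the correction `β_i x^α ∂^{β - e_i}` in `X x_i - x_i X` has
the same value of `T` as `x_i X`. -/
theorem T_mul_xGen (X : weylAlgebra K n) (i : Fin n) : T (X * xGen i) = 2 * T (xGen i * X) := by
  induction X using linear_induction with
  | hm α β =>
    simp only [monom_mul_xGen, xGen_mul_monom, map_add, map_nsmul,
      ← T_monom_add_single, two_mul]
  | ha X Y hX hY => simp only [mul_add, add_mul, map_add, hX, hY]
  | hs c X hX => simp only [mul_smul_comm, smul_mul_assoc, map_smul, hX]

theorem T_bar (X : weylAlgebra K n) : T (bar X) = T X := by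
  induction X using linear_induction with
  | hm α β =>
    rw [bar_monom, T_monom, T_monom]
    by_cases h : β = α
    · rw [h]
    · rw [if_neg h, if_neg (Ne.symm h)]
  | ha X Y hX hY => simp only [map_add, hX, hY]
  | hs c X hX => simp only [map_smul, hX]

theorem bar_mul_dGen (X : weylAlgebra K n) (i : Fin n) : bar (X * dGen i) = xGen i * bar X := by
  rw [← bar_bar (xGen i * bar X), bar_xGen_mul, bar_bar]

theorem T_dGen_mul (X : weylAlgebra K n) (i : Fin n) : T (dGen i * X) = 2 * T (X * dGen i) := by
  rw [← T_bar, bar_dGen_mul, T_mul_xGen, ← bar_mul_dGen, T_bar]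

theorem euclidForm_apply (r : K) (X Y : weylAlgebra K n) :
    euclidForm r X Y = T (weightScale r X * bar Y) := rfl

theorem euclidForm_one_left (r : K) (Y : weylAlgebra K n) : euclidForm r 1 Y = T Y := by
  rw [euclidForm_apply, weightScale_one, one_mul, T_bar]

theorem ne_zero_of_sq_eq_two {r : K} (hr2 : r ^ 2 = 2) : r ≠ 0 := by
  rintro rfl
  simp at hr2

/-- Scaling gives the factor `r` on the left; on the right, `x_i` emerges at the end of the product,
and bringing it to the front costs `2 = r ^ 2`. -/
theorem euclidForm_xGen_mul {r : K} (hr2 : r ^ 2 = 2) (i : Fin n) (X Y : weylAlgebra K n) :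
    euclidForm r (xGen i * X) Y = r⁻¹ * euclidForm r X (dGen i * Y) := by
  have hr := ne_zero_of_sq_eq_two hr2
  rw [euclidForm_apply, euclidForm_apply, bar_dGen_mul, ← mul_assoc, T_mul_xGen,
    weightScale_xGen_mul hr, smul_mul_assoc, map_smul, smul_eq_mul, mul_assoc, ← hr2]
  field_simp

theorem euclidForm_dGen_mul {r : K} (hr2 : r ^ 2 = 2) (i : Fin n) (X Y : weylAlgebra K n) :
    euclidForm r (dGen i * X) Y = r * euclidForm r X (xGen i * Y) := by
  have hr := ne_zero_of_sq_eq_two hr2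
  rw [euclidForm_apply, euclidForm_apply, bar_xGen_mul, ← mul_assoc,
    weightScale_dGen_mul hr, smul_mul_assoc, map_smul, smul_eq_mul, mul_assoc, T_dGen_mul,
    mul_assoc, ← hr2]
  field_simp

end Forms

/-! ### A weighted scalar product on a polynomial algebra -/

section PolyForm

variable {σ : Type*} [Fintype σ]

/-- The square norm `m! r^{|m|}` of the monomial with exponent `m`. -/
def polyWeight (r : K) (m : σ →₀ ℕ) : K := ((∏ i, (m i).factorial : ℕ) : K) * r ^ m.degree

/-- The bilinear form for which the monomials are orthogonal, with square norms `m! r^{|m|}`. -/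
def polyForm (r : K) : LinearMap.BilinForm K (MvPolynomial σ K) :=
  (basisMonomials σ K).constr K fun m => polyWeight r m • lcoeff K m

theorem polyForm_monomial (r : K) (m : σ →₀ ℕ) (g : MvPolynomial σ K) :
    polyForm r (monomial m 1) g = polyWeight r m * coeff m g := by
  have h : polyForm r (monomial m 1) = polyWeight r m • lcoeff K m := by
    have := (basisMonomials σ K).constr_basis K (fun m => polyWeight r m • lcoeff K m) m
    rwa [coe_basisMonomials] at this
  rw [h]
  rfl

theorem polyForm_eq_sum (r : K) (f g : MvPolynomial σ K) :
    polyForm r f g = ∑ m ∈ f.support, polyWeight r m * (coeff m f * coeff m g) := by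
  conv_lhs => rw [f.as_sum]
  rw [map_sum, LinearMap.sum_apply]
  refine Finset.sum_congr rfl fun m _ => ?_
  rw [← mul_one (coeff m f), ← smul_eq_mul, ← smul_monomial, map_smul, LinearMap.smul_apply,
    polyForm_monomial, smul_eq_mul, smul_eq_mul]
  ring

theorem polyForm_symm (r : K) (f g : MvPolynomial σ K) : polyForm r f g = polyForm r g f := by
  classical
  have h : ∀ f g : MvPolynomial σ K, polyForm r f g
      = ∑ m ∈ f.support ∪ g.support, polyWeight r m * (coeff m f * coeff m g) := by
    intro f g
    rw [polyForm_eq_sum]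
    refine Finset.sum_subset Finset.subset_union_left fun m _ hm => ?_
    rw [notMem_support_iff.1 hm, zero_mul, mul_zero]
  rw [h, h, Finset.union_comm]
  exact Finset.sum_congr rfl fun m _ => by rw [mul_comm (coeff m f)]

theorem polyWeight_add_single (r : K) (m : σ →₀ ℕ) (i : σ) :
    polyWeight r (m + Finsupp.single i 1) = r * polyWeight r m * (m i + 1) := by
  classical
  have h : (∏ j, ((m + Finsupp.single i 1 : σ →₀ ℕ) j).factorial)
      = (m i + 1) * ∏ j, (m j).factorial := by
    rw [← Finset.mul_prod_erase _ _ (Finset.mem_univ i),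
      ← Finset.mul_prod_erase _ (fun j => (m j).factorial) (Finset.mem_univ i), ← mul_assoc]
    congr 1
    · simp [Nat.factorial_succ]
    · refine Finset.prod_congr rfl fun j hj => ?_
      rw [Finsupp.add_apply, Finsupp.single_eq_of_ne (Finset.ne_of_mem_erase hj), add_zero]
  rw [polyWeight, polyWeight, h, map_add, Finsupp.degree_single, pow_succ]
  push_cast
  ring

/-- The square norms are chosen for this adjunction: passing from `m` to `m + e_i` multiplies them
by `r (m_i + 1)`. -/
theorem polyForm_X_mul (r : K) (i : σ) (f g : MvPolynomial σ K) :
    polyForm r (X i * f) g = r * polyForm r f (pderiv i g) := by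
  induction f using MvPolynomial.induction_on' with
  | monomial m a =>
    have ha : monomial m a = a • monomial m (1 : K) := by rw [smul_monomial, smul_eq_mul, mul_one]
    rw [ha, mul_smul_comm, X, monomial_mul, one_mul,
      map_smul, map_smul, LinearMap.smul_apply, LinearMap.smul_apply, polyForm_monomial,
      polyForm_monomial, coeff_pderiv, add_comm (Finsupp.single i 1), polyWeight_add_single,
      smul_eq_mul, smul_eq_mul]
    ring
  | add f f' h h' =>
    rw [mul_add, map_add, map_add, LinearMap.add_apply, LinearMap.add_apply, h, h', mul_add]

theorem polyForm_pderiv {r : K} (hr : r ≠ 0) (i : σ) (f g : MvPolynomial σ K) :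
    polyForm r (pderiv i f) g = r⁻¹ * polyForm r f (X i * g) := by
  rw [polyForm_symm r f, polyForm_X_mul, inv_mul_cancel_left₀ hr, polyForm_symm]

variable [LinearOrder K] [IsStrictOrderedRing K]

theorem polyWeight_pos {r : K} (hr : 0 < r) (m : σ →₀ ℕ) : 0 < polyWeight r m :=
  mul_pos (Nat.cast_pos.2 (Finset.prod_pos fun _ _ => Nat.factorial_pos _)) (pow_pos hr _)

theorem polyForm_self_nonneg {r : K} (hr : 0 < r) (f : MvPolynomial σ K) :
    0 ≤ polyForm r f f := by
  rw [polyForm_eq_sum]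
  exact Finset.sum_nonneg fun m _ => mul_nonneg (polyWeight_pos hr m).le (mul_self_nonneg _)

theorem polyForm_definite {r : K} (hr : 0 < r) (f : MvPolynomial σ K) (h : polyForm r f f = 0) :
    f = 0 := by
  rw [polyForm_eq_sum, Finset.sum_eq_zero_iff_of_nonneg
    fun m _ => mul_nonneg (polyWeight_pos hr m).le (mul_self_nonneg _)] at h
  ext m
  by_contra hm
  rw [coeff_zero] at hm
  have := h m (mem_support_iff.2 hm)
  exact hm (mul_self_eq_zero.1 ((mul_eq_zero.1 this).resolve_left (polyWeight_pos hr m).ne'))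

end PolyForm

/-! ### The symbol map -/

/-- The operator `p_i + ∂/∂q_i` on `K[p, q]`. -/
def shiftOp (i : Fin n) : Module.End K (MvPolynomial (Fin n ⊕ Fin n) K) :=
  LinearMap.mulLeft K (X (Sum.inl i))
    + (pderiv (Sum.inr i) : Derivation K _ (MvPolynomial (Fin n ⊕ Fin n) K)).toLinearMap

/-- The operator `q_i + 2 ∂/∂p_i` on `K[p, q]`. -/
def coshiftOp (i : Fin n) : Module.End K (MvPolynomial (Fin n ⊕ Fin n) K) :=
  LinearMap.mulLeft K (X (Sum.inr i))
    + (2 : K) • (pderiv (Sum.inl i) : Derivation K _ (MvPolynomial (Fin n ⊕ Fin n) K)).toLinearMap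

theorem shiftOp_apply (i : Fin n) (f : MvPolynomial (Fin n ⊕ Fin n) K) :
    shiftOp i f = X (Sum.inl i) * f + pderiv (Sum.inr i) f := rfl

theorem coshiftOp_apply (i : Fin n) (f : MvPolynomial (Fin n ⊕ Fin n) K) :
    coshiftOp i f = X (Sum.inr i) * f + (2 : K) • pderiv (Sum.inl i) f := rfl

/-- The commutator of two derivations is a derivation, and here it kills every variable. -/
theorem pderiv_comm {σ : Type*} (i j : σ) (f : MvPolynomial σ K) :
    pderiv i (pderiv j f) = pderiv j (pderiv i f) := by
  classical
  have h : ⁅(pderiv i : Derivation K (MvPolynomial σ K) (MvPolynomial σ K)),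
      (pderiv j : Derivation K (MvPolynomial σ K) (MvPolynomial σ K))⁆ = 0 := by
    refine MvPolynomial.derivation_ext fun k => ?_
    rw [Derivation.commutator_apply]
    simp [pderiv_X, Pi.single_apply, apply_ite]
  have := congrArg (fun D => D f) h
  simpa [Derivation.commutator_apply, sub_eq_zero] using this

theorem commute_shiftOp (i j : Fin n) : Commute (shiftOp (K := K) i) (shiftOp j) := by
  refine LinearMap.ext fun f => ?_
  simp only [Module.End.mul_apply, shiftOp_apply, map_add, Derivation.leibniz, smul_eq_mul,
    pderiv_X_of_ne Sum.inl_ne_inr, mul_zero, add_zero, pderiv_comm (Sum.inr j) (Sum.inr i)]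
  ring

/-- The Weyl relation: `2 ∂/∂p_i` against `p_j` contributes `2 δ_ij`, and `q_i` against `∂/∂q_j`
contributes `-δ_ij`. -/
theorem coshiftOp_shiftOp (i j : Fin n) (f : MvPolynomial (Fin n ⊕ Fin n) K) :
    coshiftOp i (shiftOp j f) = shiftOp j (coshiftOp i f) + if i = j then f else 0 := by
  have h : ∀ p : Fin n → Fin n ⊕ Fin n, Function.Injective p →
    pderiv (p i) (X (p j) : MvPolynomial (Fin n ⊕ Fin n) K)
      = if i = j then 1 else 0 := by
    intro p hp
    split_ifs with h
    · rw [h, pderiv_X_self]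
    · exact pderiv_X_of_ne fun h' => h (hp h').symm
  have h2 : ∀ k, pderiv k (2 : MvPolynomial (Fin n ⊕ Fin n) K) = 0 := fun k => by
    rw [← map_ofNat (C : K →+* MvPolynomial (Fin n ⊕ Fin n) K) 2, pderiv_C]
  have h' : ∀ p : Fin n → Fin n ⊕ Fin n, Function.Injective p →
    pderiv (p j) (X (p i) : MvPolynomial (Fin n ⊕ Fin n) K)
      = if i = j then 1 else 0 := by
    intro p hp
    split_ifs with h
    · rw [h, pderiv_X_self]
    · exact pderiv_X_of_ne fun h' => h (hp h')
  simp only [shiftOp_apply, coshiftOp_apply, map_add, Derivation.leibniz, smul_eq_mul,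
    h _ Sum.inl_injective, h' _ Sum.inr_injective, pderiv_comm (Sum.inr j) (Sum.inl i),
    MvPolynomial.smul_eq_C_mul, map_ofNat, h2]
  split_ifs <;> ring

theorem pairwise_commute_shiftOp_pow (s : Finset (Fin n)) (α : Fin n →₀ ℕ) :
    (s : Set (Fin n)).Pairwise (Function.onFun Commute fun i => shiftOp (K := K) i ^ α i) :=
  fun i _ j _ _ => (commute_shiftOp i j).pow_pow _ _

/-- The product of the powers `(p_i + ∂/∂q_i)^{α_i}`. -/
def shiftPow (α : Fin n →₀ ℕ) : Module.End K (MvPolynomial (Fin n ⊕ Fin n) K) :=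
  Finset.univ.noncommProd (fun i => shiftOp i ^ α i) (pairwise_commute_shiftOp_pow _ α)

theorem shiftPow_zero : shiftPow (K := K) (0 : Fin n →₀ ℕ) = 1 := by
  rw [shiftPow, Finset.noncommProd_eq_pow_card _ _ _ 1 fun i _ => by simp, one_pow]

theorem shiftPow_add_single (α : Fin n →₀ ℕ) (i : Fin n) :
    shiftPow (K := K) (α + Finsupp.single i 1) = shiftOp i * shiftPow α := by
  have h : (Finset.univ.erase i).noncommProd
        (fun j => shiftOp (K := K) j ^ (α + Finsupp.single i 1 : Fin n →₀ ℕ) j)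
        (pairwise_commute_shiftOp_pow _ _)
      = (Finset.univ.erase i).noncommProd (fun j => shiftOp j ^ α j)
        (pairwise_commute_shiftOp_pow _ _) := by
    refine Finset.noncommProd_congr rfl (fun j hj => ?_) _
    rw [Finsupp.add_apply, Finsupp.single_eq_of_ne (Finset.ne_of_mem_erase hj), add_zero]
  rw [shiftPow, shiftPow, ← Finset.mul_noncommProd_erase _ (Finset.mem_univ i) _
      (pairwise_commute_shiftOp_pow _ _), h,
    ← Finset.mul_noncommProd_erase _ (Finset.mem_univ i) _ (pairwise_commute_shiftOp_pow _ α),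
    ← mul_assoc, ← pow_succ', Finsupp.add_apply, Finsupp.single_eq_same]

/-- The polynomial in `K[p, q]` attached to the Weyl monomial `x^α ∂^β`. -/
def monomSymbol (α β : Fin n →₀ ℕ) : MvPolynomial (Fin n ⊕ Fin n) K :=
  shiftPow α (monomial (Finsupp.sumElim 0 β) 1)

theorem monomSymbol_zero (β : Fin n →₀ ℕ) :
    monomSymbol (K := K) 0 β = monomial (Finsupp.sumElim 0 β) 1 := by
  rw [monomSymbol, shiftPow_zero, Module.End.one_apply]

theorem shiftOp_monomSymbol (i : Fin n) (α β : Fin n →₀ ℕ) :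
    shiftOp i (monomSymbol (K := K) α β) = monomSymbol (α + Finsupp.single i 1) β := by
  rw [monomSymbol, monomSymbol, shiftPow_add_single, Module.End.mul_apply]

/-- This mirrors `dGen_mul_monom`, so that the symbol map intertwines `∂_i` with `coshiftOp i`. For
`α = 0` the derivative in `p_i` kills `q^β`. -/
theorem coshiftOp_monomSymbol (i : Fin n) (α β : Fin n →₀ ℕ) :
    coshiftOp i (monomSymbol (K := K) α β) = monomSymbol α (β + Finsupp.single i 1)
      + α i • monomSymbol (α - Finsupp.single i 1) β := by
  induction α using finsupp_nat_induction with
  | h0 =>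
    rw [monomSymbol_zero, monomSymbol_zero, coshiftOp_apply, pderiv_monomial, X, monomial_mul,
      Finsupp.sumElim_inl]
    have : Finsupp.single (Sum.inr i) 1 + Finsupp.sumElim (0 : Fin n →₀ ℕ) β
        = Finsupp.sumElim 0 (β + Finsupp.single i 1) := by
      ext (k | k) <;> simp [Finsupp.single_apply, add_comm]
    simp [this]
  | hs α j ih =>
    rw [← shiftOp_monomSymbol, coshiftOp_shiftOp, ih, map_add, map_nsmul, shiftOp_monomSymbol,
      shiftOp_monomSymbol, add_assoc, nsmul_shift_add_ite fun γ => monomSymbol γ β]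

theorem pderiv_shiftOp (i j : Fin n) (f : MvPolynomial (Fin n ⊕ Fin n) K) :
    pderiv (Sum.inr i) (shiftOp j f) = shiftOp j (pderiv (Sum.inr i) f) := by
  simp only [shiftOp_apply, map_add, Derivation.leibniz, smul_eq_mul,
    pderiv_X_of_ne Sum.inl_ne_inr, mul_zero, add_zero, pderiv_comm (Sum.inr i) (Sum.inr j)]

theorem pderiv_monomSymbol (i : Fin n) (α β : Fin n →₀ ℕ) :
    pderiv (Sum.inr i) (monomSymbol (K := K) α β)
      = β i • monomSymbol α (β - Finsupp.single i 1) := by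
  induction α using finsupp_nat_induction with
  | h0 =>
    have : Finsupp.sumElim (0 : Fin n →₀ ℕ) β - Finsupp.single (Sum.inr i) 1
        = Finsupp.sumElim 0 (β - Finsupp.single i 1) := by
      ext (k | k) <;> simp [Finsupp.single_apply]
    rw [monomSymbol_zero, monomSymbol_zero, pderiv_monomial, this, Finsupp.sumElim_inr, one_mul,
      ← Nat.cast_smul_eq_nsmul K, smul_monomial, smul_eq_mul, mul_one]
  | hs α j ih =>
    rw [← shiftOp_monomSymbol, pderiv_shiftOp, ih, map_nsmul, shiftOp_monomSymbol]

/-- In `p_j + ∂/∂q_j` only `p_j` raises the degree, so `p^α q^β` is the whole part of degree at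
least `|α| + |β|`. -/
theorem coeff_monomSymbol (α β : Fin n →₀ ℕ) (m : Fin n ⊕ Fin n →₀ ℕ)
    (hm : α.degree + β.degree ≤ m.degree) :
    coeff m (monomSymbol (K := K) α β) = if Finsupp.sumElim α β = m then 1 else 0 := by
  induction α using finsupp_nat_induction generalizing m with
  | h0 => rw [monomSymbol_zero, coeff_monomial]
  | hs α j ih =>
    have hE : Finsupp.sumElim (α + Finsupp.single j 1) β
        = Finsupp.sumElim α β + Finsupp.single (Sum.inl j) 1 := by
      ext (k | k) <;> simp [Finsupp.single_apply]
    have hd : (Finsupp.sumElim α β).degree = α.degree + β.degree := by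
      simp [Finsupp.degree_eq_sum]
    rw [map_add, Finsupp.degree_single] at hm
    -- The derivative term reads a coefficient at degree `|m| + 1`, beyond the degree of the
    -- previous symbol, hence zero.
    rw [← shiftOp_monomSymbol, shiftOp_apply, coeff_add, coeff_pderiv,
      ih (m + _) (by rw [map_add]; omega), if_neg, zero_mul, add_zero, mul_comm, coeff_mul_X', hE]
    · split_ifs with h1 h2 h2
      · rw [ih, if_pos]
        · rw [← h2, add_tsub_cancel_right]
        · rw [← h2, add_tsub_cancel_right, hd]
      · have hs : m - Finsupp.single (Sum.inl j) 1 + Finsupp.single (Sum.inl j) 1 = m :=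
          tsub_add_cancel_of_le (Finsupp.single_le_iff.2 (Nat.one_le_iff_ne_zero.2
            (Finsupp.mem_support_iff.1 h1)))
        have hs' := congrArg Finsupp.degree hs
        rw [map_add, Finsupp.degree_single] at hs'
        rw [ih _ (by omega), if_neg]
        rintro h
        exact h2 (by rw [h, hs])
      · refine absurd ?_ h1
        rw [← h2]
        simp
      · rfl
    · intro h
      have := congrArg Finsupp.degree h
      rw [hd, map_add, Finsupp.degree_single] at this
      omega

theorem neg_eq_neg_one_smul (X : weylAlgebra K n) : -X = (-1 : K) • X :=
  (neg_one_smul K X).symm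

/-! ### The symbol map as an isometric embedding -/

section Symbol

variable [CharZero K]

/-- The symbol map `A_n → K[p, q]`. -/
def symbol : weylAlgebra K n →ₗ[K] MvPolynomial (Fin n ⊕ Fin n) K :=
  (weylBasis K n).constr K fun p => monomSymbol p.1 p.2

theorem symbol_monom (α β : Fin n →₀ ℕ) : symbol (monom K α β) = monomSymbol α β :=
  constr_monom _ α β

theorem symbol_one : symbol (1 : weylAlgebra K n) = monomial 0 1 := by
  rw [← monom_zero_zero, symbol_monom, monomSymbol_zero, Finsupp.sumElim_zero_zero]

theorem symbol_xGen_mul (i : Fin n) (X : weylAlgebra K n) :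
    symbol (xGen i * X) = shiftOp i (symbol X) := by
  induction X using linear_induction with
  | hm α β => rw [xGen_mul_monom, symbol_monom, symbol_monom, shiftOp_monomSymbol]
  | ha X Y hX hY => rw [mul_add, map_add, map_add, map_add, hX, hY]
  | hs c X hX => rw [mul_smul_comm, map_smul, map_smul, map_smul, hX]

theorem symbol_dGen_mul (i : Fin n) (X : weylAlgebra K n) :
    symbol (dGen i * X) = coshiftOp i (symbol X) := by
  induction X using linear_induction with
  | hm α β =>
    rw [dGen_mul_monom, map_add, map_nsmul, symbol_monom, symbol_monom, symbol_monom,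
      coshiftOp_monomSymbol]
  | ha X Y hX hY => rw [mul_add, map_add, map_add, map_add, hX, hY]
  | hs c X hX => rw [mul_smul_comm, map_smul, map_smul, map_smul, hX]

/-- A Weyl monomial of maximal total degree in `X` is the only one contributing to its own leading
coefficient, so nothing cancels it. -/
theorem symbol_eq_zero {X : weylAlgebra K n} (h : symbol X = 0) : X = 0 := by
  by_contra hX
  have hs : ((weylBasis K n).repr X).support.Nonempty := by
    rw [Finsupp.support_nonempty_iff]
    simpa using hX
  obtain ⟨p, hp, hmax⟩ := Finset.exists_max_image _
    (fun q : (Fin n →₀ ℕ) × (Fin n →₀ ℕ) => q.1.degree + q.2.degree) hs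
  have h1 : coeff (Finsupp.sumElim p.1 p.2) (symbol X) = (weylBasis K n).repr X p := by
    have hd : (Finsupp.sumElim p.1 p.2).degree = p.1.degree + p.2.degree := by
      simp [Finsupp.degree_eq_sum]
    rw [symbol, Module.Basis.constr_apply, Finsupp.sum, coeff_sum, Finset.sum_eq_single p]
    · rw [coeff_smul, coeff_monomSymbol _ _ _ hd.ge, if_pos rfl, smul_eq_mul, mul_one]
    · intro q hq hqp
      rw [coeff_smul, coeff_monomSymbol _ _ _ (hd ▸ hmax q hq), if_neg, smul_zero]
      intro he
      refine hqp (Prod.ext ?_ ?_) <;> ext k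
      · exact DFunLike.congr_fun he (Sum.inl k)
      · exact DFunLike.congr_fun he (Sum.inr k)
    · intro hp'
      exact absurd hp hp'
  rw [h, coeff_zero] at h1
  exact (Finsupp.mem_support_iff.1 hp) h1.symm

/-- The adjoints of `p_i` and `∂/∂q_i` are `r ∂/∂p_i` and `r⁻¹ q_i`; their sum is `r⁻¹ (q_i + r²
∂/∂p_i)`, and `r² = 2`. -/
theorem polyForm_shiftOp {r : K} (hr2 : r ^ 2 = 2) (i : Fin n)
    (f g : MvPolynomial (Fin n ⊕ Fin n) K) :
    polyForm r (shiftOp i f) g = r⁻¹ * polyForm r f (coshiftOp i g) := by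
  have hr := ne_zero_of_sq_eq_two hr2
  rw [shiftOp_apply, coshiftOp_apply, map_add, LinearMap.add_apply, map_add, map_smul,
    polyForm_X_mul, polyForm_pderiv hr, smul_eq_mul, ← hr2]
  field_simp
  ring

theorem polyForm_coshiftOp {r : K} (hr2 : r ^ 2 = 2) (i : Fin n)
    (f g : MvPolynomial (Fin n ⊕ Fin n) K) :
    polyForm r (coshiftOp i f) g = r * polyForm r f (shiftOp i g) := by
  rw [polyForm_symm, polyForm_symm r f, polyForm_shiftOp hr2,
    mul_inv_cancel_left₀ (ne_zero_of_sq_eq_two hr2)]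

/-- Since `p_i f` has no constant term, only `∂/∂q_i` counts, which gives the recursion
`T_monom_add_single`. -/
theorem coeff_zero_monomSymbol (α β : Fin n →₀ ℕ) :
    coeff 0 (monomSymbol (K := K) α β) = T (monom K α β) := by
  induction α using finsupp_nat_induction generalizing β with
  | h0 =>
    rw [monomSymbol_zero, coeff_monomial, T_monom]
    refine if_congr ?_ (by simp) rfl
    constructor
    · intro h
      ext k
      exact (DFunLike.congr_fun h (Sum.inr k)).symm
    · rintro rfl
      exact Finsupp.sumElim_zero_zero
  | hs α i ih =>
    rw [T_monom_add_single, ← ih, ← shiftOp_monomSymbol, shiftOp_apply, pderiv_monomSymbol,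
      coeff_add, coeff_X_mul', if_neg (by simp), zero_add, ← Nat.cast_smul_eq_nsmul K, coeff_smul,
      Nat.cast_smul_eq_nsmul]

theorem euclidForm_eq_polyForm {r : K} (hr2 : r ^ 2 = 2) (X Y : weylAlgebra K n) :
    euclidForm r X Y = polyForm r (symbol X) (symbol Y) := by
  induction X using linear_induction generalizing Y with
  | hm α β =>
    refine monom_induction (p := fun X => ∀ Y, euclidForm r X Y = polyForm r (symbol X) (symbol Y))
      ?_ ?_ ?_ α β Y
    · intro Y
      rw [euclidForm_one_left, symbol_one, polyForm_monomial]
      induction Y using linear_induction with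
      | hm α β =>
        rw [symbol_monom, coeff_zero_monomSymbol]
        simp [polyWeight]
      | ha X Y hX hY => rw [map_add, map_add, coeff_add, hX, hY, mul_add]
      | hs c X hX =>
        rw [map_smul, map_smul, coeff_smul, hX, smul_eq_mul, smul_eq_mul, mul_left_comm]
    · intro i X hX Y
      rw [euclidForm_xGen_mul hr2, hX, symbol_xGen_mul, polyForm_shiftOp hr2, symbol_dGen_mul]
    · intro i X hX Y
      rw [euclidForm_dGen_mul hr2, hX, symbol_dGen_mul, polyForm_coshiftOp hr2, symbol_xGen_mul]
  | ha X Y hX hY =>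
    rw [map_add, map_add, map_add, LinearMap.add_apply, LinearMap.add_apply, hX, hY]
  | hs c X hX =>
    rw [map_smul, map_smul, map_smul, LinearMap.smul_apply, LinearMap.smul_apply, hX]

/-! ### Symmetry, right multiplications and orthogonality of the two subspaces -/

theorem bar_eq_of_mem_selfAdjointOps {X : weylAlgebra K n} (hX : X ∈ selfAdjointOps K n) :
    bar X = X := by
  induction hX using Submodule.span_induction with
  | mem X h => exact h
  | zero => exact map_zero _
  | add X Y _ _ hX hY => rw [map_add, hX, hY]
  | smul c X _ hX => rw [map_smul, hX]

theorem bar_eq_of_mem_skewAdjointOps {X : weylAlgebra K n} (hX : X ∈ skewAdjointOps K n) :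
    bar X = -X := by
  induction hX using Submodule.span_induction with
  | mem X h => exact h
  | zero => rw [neg_eq_neg_one_smul, map_zero, smul_zero]
  | add X Y _ _ hX hY =>
    rw [map_add, hX, hY, neg_eq_neg_one_smul, neg_eq_neg_one_smul Y, neg_eq_neg_one_smul (X + Y),
      smul_add]
  | smul c X _ hX =>
    rw [map_smul, hX, neg_eq_neg_one_smul, neg_eq_neg_one_smul (c • X), smul_comm]

theorem euclidForm_symm {r : K} (hr2 : r ^ 2 = 2) (X Y : weylAlgebra K n) :
    euclidForm r X Y = euclidForm r Y X := by
  rw [euclidForm_eq_polyForm hr2, euclidForm_eq_polyForm hr2, polyForm_symm]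

theorem bar_mul_xGen (X : weylAlgebra K n) (i : Fin n) : bar (X * xGen i) = dGen i * bar X := by
  rw [← bar_bar (dGen i * bar X), bar_dGen_mul, bar_bar]

theorem weightScale_mul_dGen {r : K} (hr : r ≠ 0) (i : Fin n) (X : weylAlgebra K n) :
    weightScale r (X * dGen i) = r⁻¹ • (weightScale r X * dGen i) := by
  induction X using linear_induction with
  | hm α β =>
    rw [monom_mul_dGen, weightScale_monom, weightScale_monom, smul_mul_assoc, monom_mul_dGen,
      smul_smul, weight_add_single_right, zpow_sub_one₀ hr, mul_comm]
  | ha X Y hX hY => simp only [add_mul, smul_add, map_add, hX, hY]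
  | hs c X hX => simp only [smul_mul_assoc, map_smul, hX, smul_comm c]

theorem weightScale_mul_xGen {r : K} (hr : r ≠ 0) (i : Fin n) (X : weylAlgebra K n) :
    weightScale r (X * xGen i) = r • (weightScale r X * xGen i) := by
  induction X using linear_induction with
  | hm α β =>
    simp only [map_add, map_nsmul, monom_mul_xGen, weightScale_monom, smul_mul_assoc, smul_smul,
      smul_add, weight_add_single_left]
    congr 1
    · rw [zpow_add_one₀ hr, mul_comm]
    · rcases Nat.eq_zero_or_pos (β i) with h | h
      · simp [h]
      · have hw := weight_add_single_right α (β - Finsupp.single i 1) i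
        rw [tsub_add_cancel_of_le (Finsupp.single_le_iff.2 h)] at hw
        rw [hw, zpow_sub_one₀ hr, smul_comm, mul_comm r, mul_assoc, inv_mul_cancel₀ hr, mul_one]
  | ha X Y hX hY => simp only [add_mul, smul_add, map_add, hX, hY]
  | hs c X hX => simp only [smul_mul_assoc, map_smul, hX, smul_comm c]

/-- A right factor passes directly into `bar Y`, without cycling under `T`; hence `r ≠ 0` suffices
here. -/
theorem euclidForm_mul_dGen {r : K} (hr : r ≠ 0) (i : Fin n) (X Y : weylAlgebra K n) :
    euclidForm r (X * dGen i) Y = r⁻¹ * euclidForm r X (Y * xGen i) := by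
  rw [euclidForm_apply, euclidForm_apply, bar_mul_xGen, ← mul_assoc, weightScale_mul_dGen hr,
    smul_mul_assoc, map_smul, smul_eq_mul]

theorem euclidForm_mul_xGen {r : K} (hr : r ≠ 0) (i : Fin n) (X Y : weylAlgebra K n) :
    euclidForm r (X * xGen i) Y = r * euclidForm r X (Y * dGen i) := by
  rw [euclidForm_apply, euclidForm_apply, bar_mul_dGen, ← mul_assoc, weightScale_mul_xGen hr,
    smul_mul_assoc, map_smul, smul_eq_mul]

/-- Bar turns left multiplications into right ones, and right multiplication by `∂_i` has the
adjoint constant `r⁻¹` of left multiplication by `x_i` (likewise `r` for the other pair). Induction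
on generators then reduces to `T_bar`. -/
theorem euclidForm_bar_bar {r : K} (hr2 : r ^ 2 = 2) (X Y : weylAlgebra K n) :
    euclidForm r (bar X) (bar Y) = euclidForm r X Y := by
  have hr := ne_zero_of_sq_eq_two hr2
  induction X using linear_induction generalizing Y with
  | hm α β =>
    refine monom_induction
      (p := fun X => ∀ Y, euclidForm r (bar X) (bar Y) = euclidForm r X Y) ?_ ?_ ?_ α β Y
    · intro Y
      rw [bar_one, euclidForm_one_left, euclidForm_one_left, T_bar]
    · intro i X hX Y
      rw [bar_xGen_mul, euclidForm_mul_dGen hr, ← bar_dGen_mul, hX, euclidForm_xGen_mul hr2]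
    · intro i X hX Y
      rw [bar_dGen_mul, euclidForm_mul_xGen hr, ← bar_xGen_mul, hX, euclidForm_dGen_mul hr2]
  | ha X Y hX hY =>
    rw [map_add, map_add, map_add, LinearMap.add_apply, LinearMap.add_apply, hX, hY]
  | hs c X hX =>
    rw [map_smul, map_smul, map_smul, LinearMap.smul_apply, LinearMap.smul_apply, hX]

theorem euclidForm_eq_zero_of_selfAdjoint_of_skewAdjoint {r : K} (hr2 : r ^ 2 = 2)
    {X Y : weylAlgebra K n} (hX : bar X = X) (hY : bar Y = -Y) : euclidForm r X Y = 0 := by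
  have h := euclidForm_bar_bar hr2 X Y
  rw [hX, hY, neg_eq_neg_one_smul, map_smul, smul_eq_mul, neg_one_mul] at h
  exact self_eq_neg.1 h.symm

end Symbol

/-- The form `⟨X, Y⟩` is symmetric and positive definite on the whole of `A_n`. -/
theorem isEuclidean_euclidForm [LinearOrder K] [IsStrictOrderedRing K] {r : K} (hr : 0 < r)
    (hr2 : r ^ 2 = 2) : IsEuclidean (euclidForm (n := n) r) where
  symm := euclidForm_symm hr2
  nonneg X := by
    rw [euclidForm_eq_polyForm hr2]
    exact polyForm_self_nonneg hr _
  definite X h := by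
    rw [euclidForm_eq_polyForm hr2] at h
    exact symbol_eq_zero (polyForm_definite hr _ h)

theorem IsEuclidean.restrict {F V : Type*} [Field F] [LinearOrder F] [AddCommMonoid V]
    [Module F V] {B : LinearMap.BilinForm F V} (h : IsEuclidean B) (W : Submodule F V) :
    IsEuclidean (B.restrict W) where
  symm x y := h.symm x y
  nonneg x := h.nonneg x
  definite x hx := Subtype.ext (h.definite x hx)

end

end Weyl

/-- `K` is an ordered field that contains a (positive) square root `r` of `2`, e.g. `K = ℝ`. -/
theorem mainTheorem3 {K : Type*} [Field K] [LinearOrder K] [IsStrictOrderedRing K]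
    (n : ℕ) (r : K) (hr : 0 < r) (hr2 : r ^ 2 = 2) :
    Weyl.IsEuclidean ((Weyl.euclidForm (n := n) r).restrict (Weyl.selfAdjointOps K n)) ∧
    Weyl.IsEuclidean ((Weyl.euclidForm (n := n) r).restrict (Weyl.skewAdjointOps K n)) ∧
    ∀ X ∈ Weyl.selfAdjointOps K n, ∀ Y ∈ Weyl.skewAdjointOps K n,
      Weyl.euclidForm r X Y = 0 ∧ Weyl.euclidForm r Y X = 0 := by
  refine ⟨(Weyl.isEuclidean_euclidForm hr hr2).restrict _,
    (Weyl.isEuclidean_euclidForm hr hr2).restrict _, fun X hX Y hY => ?_⟩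
  have h := Weyl.euclidForm_eq_zero_of_selfAdjoint_of_skewAdjoint hr2
    (Weyl.bar_eq_of_mem_selfAdjointOps hX) (Weyl.bar_eq_of_mem_skewAdjointOps hY)
  exact ⟨h, (Weyl.euclidForm_symm hr2 Y X).trans h⟩
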